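/- Let $W_0,W_1,W_2,\ldots$ be an acceptable numbering of all r.e. subsets of $\mathbb N$ and let $\langle\cdot,\cdot\rangle$ be a computable bijection $\mathbb N\times\mathbb N\to\mathbb N$. For $e,j\in\mathbb N$ put $L^e_j=\{x:\langle j,x\rangle\in W_e\}$ and $\mathcal L_e=\{L^e_j: j\in\mathbb N\}$; the families $\mathcal L_e$, $e\in\mathbb N$, are exactly the uniformly r.e. (u.r.e.) families. For a family $\mathcal L$ of subsets of $\mathbb N$ and $L\subseteq\mathbb N$, a set $S\subseteq\mathbb N$ is a specifying set for $L$ with respect to $\mathcal L$ if there is at most one $L'\in\mathcal L$ with $L\cap S=L'\cap S$. The extended teaching dimension $\mathrm{XTD}(\mathcal L)$ is the infimum of all $d$ such that every $L\subseteq\mathbb N$ has a specifying set with respect to $\mathcal L$ with at most $d$ elements ($\infty$ if there is no such $d\in\mathbb N$). Let $I_{XTD}=\{e:\mathrm{XTD}(\mathcal L_e)<\infty\}$. Then, for every $e\in\mathbb N$, $\mathrm{XTD}(\mathcal L_e)<\infty$ if and only if the family $\mathcal L_e$ is finite (as a set of subsets of $\mathbb N$). Moreover, $I_{XTD}$ is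 $\Sigma^0_3$-complete: there is a computable relation $R$ such that $e\in I_{XTD}\leftrightarrow(\exists y_1)(\forall y_2)(\exists y_3)\,R(e,y_1,y_2,y_3)$, and every set $B\subseteq\mathbb N$ that is definable in this form is many-one reducible to $I_{XTD}$. -/

import Mathlib

namespace Teaching

/-- `W` is an acceptable numbering of the r.e. sets: `x ∈ W e` is r.e. in `(e, x)`, and every
uniformly r.e. sequence of sets is obtained from `W` through a computable translation of indices. -/
def IsAcceptable (W : ℕ → Set ℕ) : Prop :=
  REPred (fun p : ℕ × ℕ => p.2 ∈ W p.1) ∧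
    ∀ P : ℕ × ℕ → Prop, REPred P →
      ∃ f : ℕ → ℕ, Computable f ∧ ∀ i x, x ∈ W (f i) ↔ P (i, x)

/-- `L^e_j = {x : ⟨j, x⟩ ∈ W_e}`, the `j`-th column of `W_e`. -/
def column (W : ℕ → Set ℕ) (pr : ℕ × ℕ ≃ ℕ) (e j : ℕ) : Set ℕ :=
  {x | pr (j, x) ∈ W e}

/-- The u.r.e. family `ℒ_e = {L^e_j : j ∈ ℕ}`, as a set of subsets of `ℕ`. -/
def family (W : ℕ → Set ℕ) (pr : ℕ × ℕ ≃ ℕ) (e : ℕ) : Set (Set ℕ) :=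
  {L | ∃ j, L = column W pr e j}

/-- `S` is a specifying set for `L` with respect to `F`: at most one member `L'` of `F` satisfies
`L ∩ S = L' ∩ S`. -/
def IsSpecifyingSet (S L : Set ℕ) (F : Set (Set ℕ)) : Prop :=
  ∀ L₁ ∈ F, ∀ L₂ ∈ F, L ∩ S = L₁ ∩ S → L ∩ S = L₂ ∩ S → L₁ = L₂

/-- The extended teaching dimension: the infimum of all `d` such that every subset of `ℕ` has a
specifying set with at most `d` elements. It is `⊤` if no natural number `d` has this property. -/
noncomputable def XTD (F : Set (Set ℕ)) : ℕ∞ :=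
  sInf {d : ℕ∞ | ∀ L : Set ℕ, ∃ S : Set ℕ, S.encard ≤ d ∧ IsSpecifyingSet S L F}

/-- The index set `I_XTD` of the u.r.e. families of finite extended teaching dimension. -/
def indexXTD (W : ℕ → Set ℕ) (pr : ℕ × ℕ ≃ ℕ) : Set ℕ :=
  {e | XTD (family W pr e) < ⊤}

/-- `A` is a `Σ⁰₃` set. -/
def IsSigma3 (A : Set ℕ) : Prop :=
  ∃ R : ℕ × ℕ × ℕ × ℕ → Prop, ComputablePred R ∧
    ∀ x, x ∈ A ↔ ∃ y₁, ∀ y₂, ∃ y₃, R (x, y₁, y₂, y₃)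

/-- `A` is `Σ⁰₃`-hard: every `Σ⁰₃` set is many-one reducible to `A`. -/
def IsSigma3Hard (A : Set ℕ) : Prop :=
  ∀ B : Set ℕ, IsSigma3 B → (fun x => x ∈ B) ≤₀ (fun x => x ∈ A)

/-- `A` is `Σ⁰₃`-complete. -/
def IsSigma3Complete (A : Set ℕ) : Prop :=
  IsSigma3 A ∧ IsSigma3Hard A

end Teaching

namespace Teaching

open Filter

/-! ### Finite extended teaching dimension -/

/-! An infinite family has a limit point along a nonprincipal ultrafilter; on each finite set
infinitely many members agree with it, so it has no finite specifying set. A finite family is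
separated by a single finite set, which specifies every `L`. Finiteness of `ℒ_e` says that for some
`n` every column equals one of index at most `n`. Equality of r.e. sets is `Π⁰₂`, and the bounded
choice of index can be moved behind the universal quantifiers (`exists_le_forall_iff`), which leaves
a `Σ⁰₃` condition. For hardness, `∃ i, ∀ y, p i y` with `p` r.e. is coded by the columns
`initialUnion p`: they are eventually `ℕ` if some `i` works, and otherwise are finite sets with
union `ℕ`. -/

theorem XTD_lt_top_iff (F : Set (Set ℕ)) :
    XTD F < ⊤ ↔ ∃ d : ℕ, ∀ L : Set ℕ, ∃ S : Set ℕ, S.encard ≤ d ∧ IsSpecifyingSet S L F := by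
  rw [XTD, sInf_lt_iff]
  constructor
  · rintro ⟨d, hd, hlt⟩
    lift d to ℕ using hlt.ne
    exact ⟨d, hd⟩
  · rintro ⟨d, hd⟩
    exact ⟨d, hd, ENat.natCast_lt_top d⟩

/-- An infinite family has an accumulation point, which has no finite specifying set. -/
theorem exists_not_isSpecifyingSet_of_infinite {F : Set (Set ℕ)} (hF : F.Infinite) :
    ∃ L : Set ℕ, ∀ S : Set ℕ, S.Finite → ¬ IsSpecifyingSet S L F := by
  have : Infinite F := hF.to_subtype
  let U : Ultrafilter F := hyperfilter F
  let L : Set ℕ := {x | ∀ᶠ A : F in U, x ∈ A.1}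
  refine ⟨L, fun S hS hspec => ?_⟩
  have hpt : ∀ x, ∀ᶠ A : F in U, (x ∈ L ↔ x ∈ A.1) := fun x => by
    by_cases hx : x ∈ L
    · exact Eventually.mono hx fun A hA => by simp [hx, hA]
    · exact (Ultrafilter.eventually_not.2 hx).mono fun A hA => by simp [hx, hA]
  have hagree : ∀ᶠ A : F in U, ∀ x ∈ S, (x ∈ L ↔ x ∈ A.1) :=
    (eventually_all_finite hS).2 fun x _ => hpt x
  -- A nonprincipal ultrafilter contains no finite set.
  have hinf : {A : F | ∀ x ∈ S, (x ∈ L ↔ x ∈ A.1)}.Infinite := fun hfin =>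
    hfin.notMem_hyperfilter hagree
  obtain ⟨A, hA, B, hB, hne⟩ := hinf.nontrivial
  have hinter : ∀ A : F, (∀ x ∈ S, (x ∈ L ↔ x ∈ A.1)) → L ∩ S = A.1 ∩ S := fun A h => by
    ext x
    exact and_congr_left (h x)
  exact hne (Subtype.ext (hspec A.1 A.2 B.1 B.2 (hinter A hA) (hinter B hB)))

/-- A finite family has a finite set on which its members differ pairwise. -/
theorem exists_finite_isSpecifyingSet {F : Set (Set ℕ)} (hF : F.Finite) :
    ∃ S : Set ℕ, S.Finite ∧ ∀ L, IsSpecifyingSet S L F := by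
  have hsep : ∀ A B : Set ℕ, ∃ x, A ≠ B → ¬ (x ∈ A ↔ x ∈ B) := fun A B => by
    by_cases h : A = B
    · exact ⟨0, fun hne => (hne h).elim⟩
    · rw [Set.ext_iff, not_forall] at h
      exact h.imp fun _ hx _ => hx
  choose f hf using hsep
  -- The junk points `f A A` do no harm: enlarging the set keeps it separating.
  refine ⟨Set.image2 f F F, hF.image2 f hF, fun L A hA B hB h₁ h₂ => ?_⟩
  by_contra hne
  have hx := Set.ext_iff.1 (h₁.symm.trans h₂) (f A B)
  exact hf A B hne (by simpa [Set.mem_image2_of_mem hA hB] using hx)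

theorem XTD_lt_top_iff_finite (F : Set (Set ℕ)) : XTD F < ⊤ ↔ F.Finite := by
  rw [XTD_lt_top_iff]
  constructor
  · rintro ⟨d, hd⟩
    by_contra hF
    obtain ⟨L, hL⟩ := exists_not_isSpecifyingSet_of_infinite hF
    obtain ⟨S, hS, hspec⟩ := hd L
    exact hL S (Set.finite_of_encard_le_coe hS) hspec
  · intro hF
    obtain ⟨S, hS, hspec⟩ := exists_finite_isSpecifyingSet hF
    exact ⟨S.ncard, fun L => ⟨S, hS.cast_ncard_eq.ge, hspec L⟩⟩

theorem finite_range_iff {α : Type*} (f : ℕ → α) :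
    (Set.range f).Finite ↔ ∃ n, ∀ j, ∃ i ≤ n, f j = f i := by
  constructor
  · intro h
    obtain ⟨n, hn⟩ := (h.image (Function.invFun f)).bddAbove
    exact ⟨n, fun j => ⟨Function.invFun f (f j),
      hn (Set.mem_image_of_mem _ (Set.mem_range_self j)),
      (Function.invFun_eq ⟨j, rfl⟩).symm⟩⟩
  · rintro ⟨n, hn⟩
    refine ((Set.finite_Iic n).image f).subset ?_
    rintro _ ⟨j, rfl⟩
    obtain ⟨i, hi, hij⟩ := hn j
    exact ⟨i, hi, hij.symm⟩

/-! ### Recursively enumerable predicates as projections -/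

/-- The witness `s` bounds the computation in `evaln`, which is decidable. -/
theorem exists_computable_of_rePred {α : Type*} [Primcodable α] {p : α → Prop} (hp : REPred p) :
    ∃ r : α × ℕ → Bool, Computable r ∧ ∀ a, p a ↔ ∃ s, r (a, s) = true := by
  obtain ⟨c, hc⟩ := Nat.Partrec.Code.exists_code.1 hp
  refine ⟨fun q => (Nat.Partrec.Code.evaln q.2 c (Encodable.encode q.1)).isSome,
    Primrec.option_isSome.to_comp.comp (Nat.Partrec.Code.primrec_evaln.to_comp.comp
      ((Computable.snd.pair (Computable.const c)).pair
        (Computable.encode.comp Computable.fst))), fun a => ?_⟩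
  have h1 : p a ↔ ∃ x, x ∈ Nat.Partrec.Code.eval c (Encodable.encode a) := by
    simp [hc]
  simp only [h1, Nat.Partrec.Code.evaln_complete, Option.isSome_iff_exists, Option.mem_def]
  exact exists_comm

theorem rePred_exists {α β : Type*} [Primcodable α] [Primcodable β] {r : α × β → Bool}
    (hr : Computable r) : REPred fun a => ∃ b, r (a, b) = true := by
  have hopt : Computable₂ fun (a : α) (n : ℕ) =>
      (Encodable.decode (α := β) n).bind fun b => cond (r (a, b)) (some ()) none := by
    refine Computable.option_bind (Computable.decode.comp Computable.snd) ?_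
    exact Computable.cond (hr.comp ((Computable.fst.comp Computable.fst).pair Computable.snd))
      (Computable.const _) (Computable.const _)
  refine (Partrec.rfindOpt hopt).dom_re.of_eq fun a => ?_
  rw [Nat.rfindOpt_dom]
  constructor
  · rintro ⟨n, u, hu⟩
    obtain ⟨b, -, hb⟩ := Option.bind_eq_some_iff.1 hu
    refine ⟨b, ?_⟩
    cases h : r (a, b) <;> simp_all
  · rintro ⟨b, hb⟩
    exact ⟨Encodable.encode b, (), by simp [hb]⟩

/-- Decoding of natural numbers, with a default value for those that are not codes. -/
def decodeD (β : Type*) [Primcodable β] [Inhabited β] (n : ℕ) : β :=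
  (Encodable.decode (α := β) n).getD default

section decodeD

variable {β : Type*} [Primcodable β] [Inhabited β]

theorem computable_decodeD : Computable (decodeD β) :=
  Primrec.option_getD.to_comp.comp Computable.decode (Computable.const default)

theorem decodeD_surjective : Function.Surjective (decodeD β) := fun b =>
  ⟨Encodable.encode b, by simp [decodeD]⟩

end decodeD

/-- The quantifiers of a `Σ⁰₃` definition may range over arbitrary encodable types. -/
theorem IsSigma3.of_computable {β γ δ : Type*} [Primcodable β] [Primcodable γ] [Primcodable δ]
    [Inhabited β] [Inhabited γ] [Inhabited δ] {A : Set ℕ} {r : ℕ × β × γ × δ → Bool}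
    (hr : Computable r) (hA : ∀ x, x ∈ A ↔ ∃ b, ∀ c, ∃ d, r (x, b, c, d) = true) :
    IsSigma3 A := by
  refine ⟨fun q => r (q.1, decodeD β q.2.1, decodeD γ q.2.2.1, decodeD δ q.2.2.2) = true,
    ComputablePred.computable_iff.2 ⟨_, hr.comp (Computable.fst.pair
      ((computable_decodeD.comp (Computable.fst.comp Computable.snd)).pair
        ((computable_decodeD.comp (Computable.fst.comp (Computable.snd.comp Computable.snd))).pair
          (computable_decodeD.comp (Computable.snd.comp (Computable.snd.comp Computable.snd)))))),
      rfl⟩, fun x => ?_⟩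
  rw [hA, decodeD_surjective.exists]
  refine exists_congr fun _ => ?_
  rw [decodeD_surjective.forall]
  refine forall_congr' fun _ => ?_
  rw [decodeD_surjective.exists]

/-! ### The index set is `Σ⁰₃` -/

/-- A bounded disjunction of universal statements, with the universal quantifiers in front: the
list `g` holds one challenge for each disjunct. -/
theorem exists_le_forall_iff {α : Type*} [Inhabited α] (n : ℕ) (p : ℕ → α → Prop) :
    (∃ i ≤ n, ∀ a, p i a) ↔ ∀ g : List α, ∃ i ≤ n, p i (g.getD i default) := by
  constructor
  · rintro ⟨i, hi, h⟩ g
    exact ⟨i, hi, h _⟩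
  · intro h
    by_contra! hcon
    choose! c hc using hcon
    -- The list of counterexamples, one for each `i ≤ n`, defeats every disjunct at once.
    obtain ⟨i, hi, hp⟩ := h ((List.range (n + 1)).map c)
    refine hc i hi ?_
    have hlt : i < n + 1 := Nat.lt_succ_of_le hi
    simpa [List.getD, hlt] using hp

theorem family_eq_range (W : ℕ → Set ℕ) (pr : ℕ × ℕ ≃ ℕ) (e : ℕ) :
    family W pr e = Set.range (column W pr e) := by
  ext L
  simp [family, eq_comm]

/-- Two projections agree if and only if every witness for membership in one of them is answered by
a witness for membership in the other. -/
theorem eq_iff_forall_exists {a b : ℕ × ℕ → Bool} {A B : Set ℕ}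
    (ha : ∀ x, x ∈ A ↔ ∃ s, a (x, s) = true) (hb : ∀ x, x ∈ B ↔ ∃ s, b (x, s) = true) :
    A = B ↔ ∀ q : ℕ × ℕ, ∃ t : ℕ × ℕ,
      ((!a q || b (q.1, t.1)) && (!b q || a (q.1, t.2))) = true := by
  simp only [Bool.and_eq_true, Bool.or_eq_true, Bool.not_eq_true']
  constructor
  · rintro rfl ⟨x, s⟩
    by_cases hx : x ∈ A
    · obtain ⟨t₁, h₁⟩ := (hb x).1 hx
      obtain ⟨t₂, h₂⟩ := (ha x).1 hx
      exact ⟨(t₁, t₂), Or.inr h₁, Or.inr h₂⟩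
    · refine ⟨(0, 0), Or.inl ?_, Or.inl ?_⟩
      · exact Bool.eq_false_iff.2 fun h => hx ((ha x).2 ⟨s, h⟩)
      · exact Bool.eq_false_iff.2 fun h => hx ((hb x).2 ⟨s, h⟩)
  · intro h
    ext x
    rw [ha, hb]
    constructor
    · rintro ⟨s, hs⟩
      obtain ⟨t, ht, -⟩ := h (x, s)
      exact ⟨t.1, ht.resolve_left (by simp [hs])⟩
    · rintro ⟨s, hs⟩
      obtain ⟨t, -, ht⟩ := h (x, s)
      exact ⟨t.2, ht.resolve_left (by simp [hs])⟩

theorem isSigma3_indexXTD {W : ℕ → Set ℕ} (hW : REPred fun p : ℕ × ℕ => p.2 ∈ W p.1)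
    {pr : ℕ × ℕ ≃ ℕ} (hpr : Computable pr) : IsSigma3 (indexXTD W pr) := by
  obtain ⟨w, hw, hwW⟩ := exists_computable_of_rePred hW
  let a : ℕ → ℕ → ℕ × ℕ → Bool := fun e j q => w ((e, pr (j, q.1)), q.2)
  have ha : ∀ e j x, x ∈ column W pr e j ↔ ∃ s, a e j (x, s) = true := fun e j x =>
    hwW (e, pr (j, x))
  have hac : ∀ {η : Type} [Primcodable η] {e j x s : η → ℕ}, Computable e → Computable j →
      Computable x → Computable s → Computable fun v => a (e v) (j v) (x v, s v) :=
    fun he hj hx hs => hw.comp ((he.pair (hpr.comp (hj.pair hx))).pair hs)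
  -- The blocks are `∃ n`, `∀ (j, g)`, `∃ (i, t)`: the index `i` is chosen after the challenge list
  -- `g`, and `t` answers the challenge in entry `i`.
  let r : ℕ × ℕ × (ℕ × List (ℕ × ℕ)) × (ℕ × ℕ × ℕ) → Bool := fun v =>
    let e := v.1
    let n := v.2.1
    let j := v.2.2.1.1
    let i := v.2.2.2.1
    let q := v.2.2.1.2.getD i default
    let t := v.2.2.2.2
    decide (i ≤ n) && ((!a e j (q.1, q.2) || a e i (q.1, t.1)) &&
      (!a e i (q.1, q.2) || a e j (q.1, t.2)))
  refine IsSigma3.of_computable (r := r) ?_ fun e => ?_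
  · have he : Computable fun v : ℕ × ℕ × (ℕ × List (ℕ × ℕ)) × (ℕ × ℕ × ℕ) => v.1 := Computable.fst
    have h2 : Computable fun v : ℕ × ℕ × (ℕ × List (ℕ × ℕ)) × (ℕ × ℕ × ℕ) => v.2 := Computable.snd
    have hn := Computable.fst.comp h2
    have h3 := Computable.snd.comp h2
    have hjg := Computable.fst.comp h3
    have hj := Computable.fst.comp hjg
    have hit := Computable.snd.comp h3
    have hi := Computable.fst.comp hit
    have ht := Computable.snd.comp hit
    have hq := (Primrec.list_getD (default : ℕ × ℕ)).to_comp.comp (Computable.snd.comp hjg) hi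
    have hx := Computable.fst.comp hq
    have hs := Computable.snd.comp hq
    have hle := Primrec.nat_le.decide.to_comp.comp hi hn
    have himp : ∀ {f g : ℕ × ℕ × (ℕ × List (ℕ × ℕ)) × (ℕ × ℕ × ℕ) → Bool}, Computable f →
        Computable g → Computable fun v => !f v || g v := fun hf hg =>
      Primrec.or.to_comp.comp (Primrec.not.to_comp.comp hf) hg
    exact Primrec.and.to_comp.comp hle (Primrec.and.to_comp.comp
      (himp (hac he hj hx hs) (hac he hi hx (Computable.fst.comp ht)))
      (himp (hac he hi hx hs) (hac he hj hx (Computable.snd.comp ht))))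
  · change XTD _ < ⊤ ↔ _
    rw [XTD_lt_top_iff_finite, family_eq_range, finite_range_iff]
    refine exists_congr fun n => ?_
    rw [Prod.forall]
    refine forall_congr' fun j => ?_
    simp only [eq_iff_forall_exists (ha e j) (ha e _)]
    rw [exists_le_forall_iff n fun i q => ∃ t : ℕ × ℕ,
      ((!a e j q || a e i (q.1, t.1)) && (!a e i q || a e j (q.1, t.2))) = true]
    refine forall_congr' fun g => ?_
    rw [Prod.exists]
    refine exists_congr fun i => ?_
    simp [r]

/-! ### The index set is `Σ⁰₃`-hard -/

/-- The `j`-th set is `[0, j)` together with all numbers `z` such that, for some `i ≤ j`, the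
predicate `p i` holds up to `z`. -/
def initialUnion (p : ℕ → ℕ → Prop) (j : ℕ) : Set ℕ :=
  {z | z < j ∨ ∃ i ≤ j, ∀ y ≤ z, p i y}

theorem finite_range_initialUnion_iff (p : ℕ → ℕ → Prop) :
    (Set.range (initialUnion p)).Finite ↔ ∃ i, ∀ y, p i y := by
  constructor
  · intro h
    by_contra! hcon
    choose c hc using hcon
    -- As `p i` fails at `c i`, each `i ≤ j` contributes only numbers below `c i`.
    have hfin : ∀ j, (initialUnion p j).Finite := fun j => by
      refine ((Set.finite_Iio j).union
        ((Set.finite_Iic j).biUnion fun i _ => Set.finite_Iio (c i))).subset ?_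
      rintro z (hz | ⟨i, hi, hz⟩)
      · exact Or.inl hz
      · exact Or.inr (Set.mem_biUnion hi (not_le.1 fun hle => hc i (hz _ hle)))
    have hun : (⋃₀ Set.range (initialUnion p)).Finite :=
      h.sUnion (by rintro _ ⟨j, rfl⟩; exact hfin j)
    refine Set.infinite_univ (hun.subset fun z _ => ?_)
    exact ⟨_, ⟨z + 1, rfl⟩, Or.inl (Nat.lt_succ_self z)⟩
  · rintro ⟨i, hi⟩
    refine (finite_range_iff _).2 ⟨i, fun j => ?_⟩
    have huniv : ∀ k, i ≤ k → initialUnion p k = Set.univ := fun k hk =>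
      Set.eq_univ_of_forall fun z => Or.inr ⟨i, hk, fun y _ => hi y⟩
    rcases le_total i j with hij | hij
    · exact ⟨i, le_rfl, by rw [huniv j hij, huniv i le_rfl]⟩
    · exact ⟨j, hij, rfl⟩

theorem computable_forall_lt {α : Type*} [Primcodable α] {r : α × ℕ → Bool} (hr : Computable r)
    {f : α → ℕ} (hf : Computable f) : Computable fun a => decide (∀ y < f a, r (a, y) = true) := by
  have hstep : Computable₂ fun (a : α) (q : ℕ × Bool) => q.2 && r (a, q.1) :=
    Primrec.and.to_comp.comp (Computable.snd.comp Computable.snd)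
      (hr.comp (Computable.fst.pair (Computable.fst.comp Computable.snd)))
  refine (Computable.nat_rec hf (Computable.const true) hstep).of_eq fun a => ?_
  induction f a with
  | zero => simp
  | succ n ih =>
    rw [Bool.eq_iff_iff] at ih ⊢
    simp only [Bool.and_eq_true, ih, decide_eq_true_eq, Nat.forall_lt_succ_right]

/-- A list of witnesses for the values up to `z`. -/
theorem forall_le_exists_iff (z : ℕ) (p : ℕ → ℕ → Prop) :
    (∀ y ≤ z, ∃ t, p y t) ↔ ∃ g : List ℕ, ∀ y < z + 1, p y (g.getD y 0) := by
  constructor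
  · intro h
    choose! c hc using h
    refine ⟨(List.range (z + 1)).map c, fun y hy => ?_⟩
    simpa [List.getD, hy] using hc y (Nat.le_of_lt_succ hy)
  · rintro ⟨g, hg⟩ y hy
    exact ⟨_, hg y (Nat.lt_succ_of_le hy)⟩

theorem rePred_initialUnion {r : ℕ × ℕ × ℕ × ℕ → Bool} (hr : Computable r)
    {pr : ℕ × ℕ ≃ ℕ} (hpr : Computable pr.symm) :
    REPred fun v : ℕ × ℕ => (pr.symm v.2).2 ∈
      initialUnion (fun i y => ∃ t, r (v.1, i, y, t) = true) (pr.symm v.2).1 := by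
  -- The witness `u.2` is an index `i` with a list of values `t`, one for each `y ≤ z`.
  let b : (ℕ × ℕ) × (ℕ × List ℕ) → Bool := fun u =>
    decide ((pr.symm u.1.2).2 < (pr.symm u.1.2).1) ||
      (decide (u.2.1 ≤ (pr.symm u.1.2).1) &&
        decide (∀ y < (pr.symm u.1.2).2 + 1, r (u.1.1, u.2.1, y, u.2.2.getD y 0) = true))
  have hb : Computable b := by
    have hx : Computable fun u : (ℕ × ℕ) × (ℕ × List ℕ) => u.1.1 :=
      Computable.fst.comp Computable.fst
    have hi : Computable fun u : (ℕ × ℕ) × (ℕ × List ℕ) => u.2.1 :=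
      Computable.fst.comp Computable.snd
    have hg : Computable fun u : (ℕ × ℕ) × (ℕ × List ℕ) => u.2.2 :=
      Computable.snd.comp Computable.snd
    have hjz : Computable fun u : (ℕ × ℕ) × (ℕ × List ℕ) => pr.symm u.1.2 :=
      hpr.comp (Computable.snd.comp Computable.fst)
    have hj := Computable.fst.comp hjz
    have hz := Computable.snd.comp hjz
    have hall : Computable fun q : ((ℕ × ℕ) × (ℕ × List ℕ)) × ℕ =>
        r (q.1.1.1, q.1.2.1, q.2, q.1.2.2.getD q.2 0) :=
      hr.comp ((hx.comp Computable.fst).pair ((hi.comp Computable.fst).pair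
        (Computable.snd.pair ((Primrec.list_getD 0).to_comp.comp (hg.comp Computable.fst)
          Computable.snd))))
    exact Primrec.or.to_comp.comp (Primrec.nat_lt.decide.to_comp.comp hz hj)
      (Primrec.and.to_comp.comp (Primrec.nat_le.decide.to_comp.comp hi hj)
        (computable_forall_lt hall (Computable.succ.comp hz)))
  refine (rePred_exists hb).of_eq fun v => ?_
  simp only [initialUnion, Set.mem_ofPred_eq, forall_le_exists_iff, b, Bool.or_eq_true,
    Bool.and_eq_true, decide_eq_true_eq, Prod.exists, exists_or, exists_const, exists_and_left]

theorem isSigma3Hard_indexXTD {W : ℕ → Set ℕ} (hW : IsAcceptable W)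
    {pr : ℕ × ℕ ≃ ℕ} (hpr : Computable pr.symm) : IsSigma3Hard (indexXTD W pr) := by
  rintro B ⟨R, hR, hB⟩
  obtain ⟨r, hr, rfl⟩ := ComputablePred.computable_iff.1 hR
  obtain ⟨f, hf, hfW⟩ := hW.2 _ (rePred_initialUnion hr hpr)
  refine ⟨f, hf, fun x => ?_⟩
  have hcol : column W pr (f x) = initialUnion fun i y => ∃ t, r (x, i, y, t) = true := by
    ext j z
    simp [column, hfW]
  change x ∈ B ↔ XTD _ < ⊤
  rw [XTD_lt_top_iff_finite, family_eq_range, hcol, finite_range_initialUnion_iff]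
  exact hB x

end Teaching

theorem mainTheorem7 (W : ℕ → Set ℕ) (hW : Teaching.IsAcceptable W)
    (pr : ℕ × ℕ ≃ ℕ) (hpr : pr.Computable) :
    (∀ e : ℕ, Teaching.XTD (Teaching.family W pr e) < ⊤ ↔ (Teaching.family W pr e).Finite) ∧
      Teaching.IsSigma3Complete (Teaching.indexXTD W pr) :=
  ⟨fun _ => Teaching.XTD_lt_top_iff_finite _,
    Teaching.isSigma3_indexXTD hW.1 hpr.1, Teaching.isSigma3Hard_indexXTD hW hpr.2⟩
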